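/- Let $G=(\mathcal V,\mathcal E)$ be a finite connected simple graph. For $U\subset\mathcal V$ let $\mathcal E(U)$ be the set of nodes adjacent to some element of $U$; an independent set is a non-empty set of pairwise non-adjacent nodes. Let $\textsc{Ncond}(G)$ be the set of probability measures $\mu$ with full support on $\mathcal V$ such that $\mu(\mathcal I)<\mu(\mathcal E(\mathcal I))$ for every independent set $\mathcal I$. A list of preferences is a family $\sigma=(\sigma(v))_{v\in\mathcal V}$ of permutations $\sigma(v)$ of $\mathcal E(\{v\})$; $\mathcal S$ is the set of these. Let $\mathbb W$ be the set of finite words on $\mathcal V$ in which no two adjacent classes both appear, and $\mathbb W_2$ the set of its words of even length. An admissible matching policy $\phi$ consists of a law $\nu_\phi$ on $\mathcal S$ and of a rule such that an item of class $v$ with list of preferences $\sigma$ entering a system whose queue is $w\in\mathbb W$ (unmatched items, in order of arrival) is matched with one compatible stored item, chosen as a function of $(w,v,\sigma)$ only, if there is one (the latter is then removed from $w$); otherwise $v$ is appended to $w$. The resulting queue is denoted $w\odot_\phi(v,\sigma)$, and $Q_\phi(z,\varsigma)$ is the queue obtained from the empty queue $\emptyset$ after the arrivals of the letters of $z$ with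 lists of preferences $\varsigma$. A word $z$ of even length is a strong erasing word for $(G,\phi)$ if, for all lists of preferences of positive $\nu_\phi$-probability, $Q_\phi(ijz,\cdot)=\emptyset$ for all (possibly equal) non-adjacent $i,j\in\mathcal V$, and $Q_\phi(z',\cdot)=\emptyset$ for every right sub-word $z'$ of $z$ of even length. Let $(V_n,\Sigma_n)_{n\in\mathbb Z}$ be $\mathcal V\times\mathcal S$-valued random variables on a probability space such that the sequence $(V_{2n},\Sigma_{2n},V_{2n+1},\Sigma_{2n+1})_{n\in\mathbb Z}$ is stationary and ergodic, with marginals $\mu^0,\nu_\phi,\mu^1,\nu_\phi$ for every $n$, and such that $\mu:=(\mu^0+\mu^1)/2$ has full support. Let $\mathbb P^0$ be the law of this sequence on $\Omega^0=(\mathcal V\times\mathcal S\times\mathcal V\times\mathcal S)^{\mathbb Z}$, $\theta$ the shift of $\Omega^0$, $(\theta\omega)_n=\omega_{n+1}$, and $(V^0,\Sigma^0,V^1,\Sigma^1)$ the $0$-coordinate. For a $\mathbb W_2$-valued random variable $Y$ on $\Omega^0$ let $U^{[Y]}_0=Y$ and $U^{[Y]}_{n+1}=\big(U^{[Y]}_n\odot_\phi(V^0\circ\theta^n,\Sigma^0\circ\theta^n)\big)\odot_\phi(V^1\circ\theta^n,\Sigma^1\circ\theta^n)$,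 and let $\mathscr A_n(Y)=\{U^{[Y]}_n=\emptyset\}$, $n\ge 0$. For words $z^1,\dots,z^r$ of even length let $\mathscr B^r(z^1,\dots,z^r)$ be the event that $V^0\,V^1\,V^0\circ\theta\,V^1\circ\theta\cdots V^0\circ\theta^{m-1}\,V^1\circ\theta^{m-1}=z^1z^2\cdots z^r$, where $m=\frac12\sum_i|z^i|$. Consider the renovation conditions $$\lim_{n\to\infty}\mathbb P^0\Big[\bigcap_{k=0}^\infty\bigcup_{l=0}^n\mathscr A_l(Y)\cap\theta^k\mathscr A_{l+k}(Y)\Big]=1,\qquad(\mathrm R_0)$$ $$\lim_{n\to\infty}\mathbb P^0\Big[\bigcap_{k=0}^\infty\bigcup_{l=0}^n\mathscr A_l(\emptyset)\cap\theta^k\mathscr A_{l+k}(\emptyset)\cap\theta^{-l}\mathscr B^r(z^1,\dots,z^r)\Big]=1.\qquad(\mathrm R_1)$$ **Proposition.** If $(\mathrm R_1)$ holds for some $r\ge1$ and some strong erasing words $z^1,\dots,z^r$ for $(G,\phi)$, then $\mu\in\textsc{Ncond}(G)$; in particular $\mu\in\textsc{Ncond}(G)$ whenever $(\mathrm R_0)$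 and $(\mathrm R_1)$ hold. Moreover, if $(\mathrm R_0)$ holds for some $\mathbb W_2$-valued random variable $Y$, then $\mu(\mathcal I)\le\mu(\mathcal E(\mathcal I))$ for every independent set $\mathcal I$ of $G$. -/

import Mathlib

open MeasureTheory Filter Topology
open scoped ENNReal

namespace GeneralMatching

/-! ### Compatibility graph -/

section Graph

variable {V : Type*}

/-- The neighbourhood `E(U)` of a set `U` of nodes. -/
def neighbors (G : SimpleGraph V) (U : Set V) : Set V := {v | ∃ u ∈ U, G.Adj u v}

/-- The family of independent sets of `G`; these are non-empty by convention. -/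
def independentSets (G : SimpleGraph V) : Set (Set V) := {I | I.Nonempty ∧ G.IsIndepSet I}

/-- The probability measures on the set of classes which have full support. -/
def fullSupportLaws (V : Type*) [MeasurableSpace V] : Set (Measure V) :=
  {μ | IsProbabilityMeasure μ ∧ ∀ v, μ {v} ≠ 0}

/-- The set `Ncond(G)`. -/
def Ncond (G : SimpleGraph V) [MeasurableSpace V] : Set (Measure V) :=
  {μ | μ ∈ fullSupportLaws V ∧ ∀ I ∈ independentSets G, μ I < μ (neighbors G I)}

end Graph

/-! ### Lists of preferences, queue details and matching policies -/

section Model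

variable {V : Type*}

/-- A list of preferences: for each class `v`, a permutation of the classes compatible
with `v`. -/
def PreferenceList (G : SimpleGraph V) : Type _ := ∀ v : V, Equiv.Perm (G.neighborSet v)

instance (G : SimpleGraph V) : MeasurableSpace (PreferenceList G) := ⊤

/-- A queue detail: a word on the classes, in which no two compatible classes both appear. -/
structure QueueDetail (G : SimpleGraph V) where
  word : List V
  admissible : ∀ i j, G.Adj i j → i ∈ word → j ∉ word

/-- The empty queue detail. -/
def QueueDetail.empty (G : SimpleGraph V) : QueueDetail G := ⟨[], by simp⟩

instance (G : SimpleGraph V) : MeasurableSpace (QueueDetail G) := ⊤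

/-- The queue details of even length. -/
def evenQueueDetails (G : SimpleGraph V) : Set (QueueDetail G) := {w | Even w.word.length}

/-- An admissible matching policy. It consists of the law `prefLaw` of the lists of preferences,
and of a rule which, given the queue detail, the class of the entering item and the list of
preferences drawn upon arrival, designates (by its position in the queue) a compatible
stored item, whenever there is one. -/
structure AdmissiblePolicy (G : SimpleGraph V) where
  prefLaw : PMF (PreferenceList G)
  choice : ∀ (w : QueueDetail G) (v : V) (_ : PreferenceList G),
    (∃ k : Fin w.word.length, G.Adj v (w.word.get k)) →
      {k : Fin w.word.length // G.Adj v (w.word.get k)}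

open Classical in
/-- The queue detail just after the arrival of an item of class `v` with list of
preferences `σ`: the chosen stored item is removed if there is a compatible one, and otherwise
the entering item is stored at the end of the queue. -/
noncomputable def AdmissiblePolicy.step {G : SimpleGraph V} (φ : AdmissiblePolicy G)
    (w : QueueDetail G) (a : V × PreferenceList G) : QueueDetail G :=
  if h : ∃ k : Fin w.word.length, G.Adj a.1 (w.word.get k) then
    ⟨w.word.eraseIdx (φ.choice w a.1 a.2 h).1, fun i j hij hi hj =>
      w.admissible i j hij (List.mem_of_mem_eraseIdx hi) (List.mem_of_mem_eraseIdx hj)⟩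
  else
    ⟨w.word ++ [a.1], by
      have hfree : ∀ x ∈ w.word, ¬ G.Adj a.1 x := by
        intro x hx hadj
        obtain ⟨k, rfl⟩ := List.get_of_mem hx
        exact h ⟨k, hadj⟩
      intro i j hij hi hj
      simp only [List.mem_append, List.mem_singleton] at hi hj
      rcases hi with hi | rfl <;> rcases hj with hj | rfl
      · exact w.admissible i j hij hi hj
      · exact hfree i hi hij.symm
      · exact hfree j hj hij
      · exact G.irrefl hij⟩

/-- The queue detail obtained from an initially empty system, once the successive items of a
finite word have entered with the given lists of preferences. -/
noncomputable def AdmissiblePolicy.queue {G : SimpleGraph V} (φ : AdmissiblePolicy G)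
    (l : List (V × PreferenceList G)) : QueueDetail G :=
  l.foldl φ.step (QueueDetail.empty G)

/-- A strong erasing word `z` for `(G, φ)`: its length is even; `i j z` is completely matched for
any two (possibly equal) non-adjacent classes `i`, `j`; every right sub-word of `z` of even
length is completely matched; all this for every sequence of lists of preferences
that can be drawn from `prefLaw`. -/
structure IsStrongErasingWord {G : SimpleGraph V} (φ : AdmissiblePolicy G) (z : List V) :
    Prop where
  even_length : Even z.length
  erases : ∀ i j : V, ¬ G.Adj i j → ∀ s : List (PreferenceList G),
    s.length = z.length + 2 → (∀ σ ∈ s, σ ∈ φ.prefLaw.support) →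
      φ.queue ((i :: j :: z).zip s) = QueueDetail.empty G
  suffix_matched : ∀ l : ℕ, 2 * l < z.length → ∀ s : List (PreferenceList G),
    s.length = (z.drop (2 * l)).length → (∀ σ ∈ s, σ ∈ φ.prefLaw.support) →
      φ.queue ((z.drop (2 * l)).zip s) = QueueDetail.empty G

end Model

/-! ### Paired input and its canonical space -/

section Input

variable {V : Type*}

/-- The data `(V⁰, Σ⁰, V¹, Σ¹)` of a pair of successive arrivals. -/
abbrev Pair (G : SimpleGraph V) : Type _ :=
  V × PreferenceList G × V × PreferenceList G

/-- The canonical space of bi-infinite sequences of pairs of arrivals. -/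
abbrev PairedInput (G : SimpleGraph V) : Type _ := ℤ → Pair G

/-- The `k`-th iterate, for an integer `k`, of the shift of the canonical space. -/
def shift {G : SimpleGraph V} (k : ℤ) (ω : PairedInput G) : PairedInput G := fun n => ω (n + k)

/-- The paired input associated with a sequence of arrivals: the `n`-th pair consists of
the arrivals of indices `2n` and `2n+1`. -/
def pairing {Ω : Type*} {G : SimpleGraph V} (X : ℤ → Ω → V) (S : ℤ → Ω → PreferenceList G)
    (x : Ω) : PairedInput G :=
  fun n => (X (2 * n) x, S (2 * n) x, X (2 * n + 1) x, S (2 * n + 1) x)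

/-- The image law of the paired input on the canonical space. -/
noncomputable def palmLaw {Ω : Type*} [MeasurableSpace Ω] {G : SimpleGraph V} [MeasurableSpace V]
    (ℙ : Measure Ω) (X : ℤ → Ω → V) (S : ℤ → Ω → PreferenceList G) : Measure (PairedInput G) :=
  ℙ.map (pairing X S)

/-- The average `(μ⁰ + μ¹) / 2`. -/
noncomputable def averageLaw [MeasurableSpace V] (μ₀ μ₁ : Measure V) : Measure V :=
  (2⁻¹ : ℝ≥0∞) • (μ₀ + μ₁)

/-- The paired input is stationary and ergodic, with marginals `μ₀`, `prefLaw`, `μ₁`,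
`prefLaw`, and `(μ₀ + μ₁) / 2` has full support. (`Ergodic` includes the invariance of the law
under the shift.) -/
structure StationaryErgodicPairedInput {Ω : Type*} [MeasurableSpace Ω] {G : SimpleGraph V}
    [MeasurableSpace V] (φ : AdmissiblePolicy G) (ℙ : Measure Ω) (X : ℤ → Ω → V)
    (S : ℤ → Ω → PreferenceList G) (μ₀ μ₁ : Measure V) : Prop where
  measurable_class : ∀ n, Measurable (X n)
  measurable_pref : ∀ n, Measurable (S n)
  ergodic : Ergodic (shift 1) (palmLaw ℙ X S)
  first_marginal : ∀ n, ℙ.map (X (2 * n)) = μ₀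
  second_marginal : ∀ n, ℙ.map (S (2 * n)) = φ.prefLaw.toMeasure
  third_marginal : ∀ n, ℙ.map (X (2 * n + 1)) = μ₁
  fourth_marginal : ∀ n, ℙ.map (S (2 * n + 1)) = φ.prefLaw.toMeasure
  full_support : averageLaw μ₀ μ₁ ∈ fullSupportLaws V

end Input

/-! ### Even buffer content, renovating events and renovation conditions -/

section Renovation

variable {V : Type*} {G : SimpleGraph V}

/-- The buffer content `U_n^{[Y]}` at even times, started at the value `Y` at time `0`. -/
noncomputable def evenBuffer (φ : AdmissiblePolicy G) (Y : PairedInput G → QueueDetail G) :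
    ℕ → PairedInput G → QueueDetail G
  | 0, ω => Y ω
  | n + 1, ω =>
    φ.step (φ.step (evenBuffer φ Y n ω) ((ω n).1, (ω n).2.1)) ((ω n).2.2.1, (ω n).2.2.2)

/-- The event `A_n(Y)` that the even buffer content started at `Y` is empty at time `n`. -/
def emptyEvent (φ : AdmissiblePolicy G) (Y : PairedInput G → QueueDetail G) (n : ℕ) :
    Set (PairedInput G) :=
  {ω | evenBuffer φ Y n ω = QueueDetail.empty G}

/-- The word formed by the classes of the first `m` pairs of arrivals, from time `0` on. -/
def arrivalWord (m : ℕ) (ω : PairedInput G) : List V :=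
  (List.range m).flatMap fun n => [(ω n).1, (ω n).2.2.1]

/-- The event `B^r(z¹, …, z^r)` that the arrivals from time `0` on start with the word
`z¹ z² ⋯ z^r`. -/
def arrivalEvent (G : SimpleGraph V) {r : ℕ} (z : Fin r → List V) : Set (PairedInput G) :=
  {ω | arrivalWord ((∑ i, (z i).length) / 2) ω = (List.ofFn z).flatten}

variable [MeasurableSpace V]

/-- The renovation condition for the initial value `Y`:
`P (⋂_{k ≥ 0} ⋃_{l ≤ n} A_l(Y) ∩ θ^k A_{l+k}(Y)) → 1` as `n → ∞`. -/
def RenovationCondition (φ : AdmissiblePolicy G) (P : Measure (PairedInput G))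
    (Y : PairedInput G → QueueDetail G) : Prop :=
  Tendsto (fun n : ℕ => P (⋂ k : ℕ, ⋃ l : ℕ, ⋃ _ : l ≤ n,
    emptyEvent φ Y l ∩ shift (k : ℤ) '' emptyEvent φ Y (l + k))) atTop (𝓝 1)

/-- The renovation condition for the empty initial value and the words `z¹, …, z^r`:
`P (⋂_{k ≥ 0} ⋃_{l ≤ n} A_l(∅) ∩ θ^k A_{l+k}(∅) ∩ θ^{-l} B^r(z¹, …, z^r)) → 1` as `n → ∞`. -/
def ErasingRenovationCondition (φ : AdmissiblePolicy G) (P : Measure (PairedInput G))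
    {r : ℕ} (z : Fin r → List V) : Prop :=
  Tendsto (fun n : ℕ => P (⋂ k : ℕ, ⋃ l : ℕ, ⋃ _ : l ≤ n,
    emptyEvent φ (fun _ => QueueDetail.empty G) l ∩
      shift (k : ℤ) '' emptyEvent φ (fun _ => QueueDetail.empty G) (l + k) ∩
      shift (-(l : ℤ)) '' arrivalEvent G z)) atTop (𝓝 1)

end Renovation

end GeneralMatching

namespace GeneralMatching

/-! ### The weight of a class relative to a set of nodes -/

section Weight

variable {V : Type*} {G : SimpleGraph V}

/-! Give each class the weight $f=1_I-1_{\mathcal E(I)}$. Two compatible classes have total weight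
at most 0, so a match never lowers the weight of the queue below what mere storage would give: the
final queue weighs at least as much as the initial queue plus the arrivals
(`le_wordWeight_evenBuffer`). An emptied system therefore bounds the drift, i.e. the total weight of
the arrivals. By stationarity the mean drift of a pair is $2(\mu(I)-\mu(\mathcal E(I)))$, so only
its sign is at stake.

Under $(\mathrm R_0)$, with probability close to 1 the drift over $[-k,0)$ is at most
$2n+|Y\circ\theta^{-k}|$ for each $k$, and the second term is tight by stationarity. A positive mean
would make the expected drift grow linearly in $k$ at a rate that the small exceptional event cannot
supply.

Under $(\mathrm R_1)$ the mean must also be shown nonzero. A strong erasing word weighs at most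
$-2$, since it still erases $ii$ with $i\in I$. Let $W_K$ be the maximal drift over windows of
length at most $K$ ending at 0. In general $W_{K+L}\circ\theta^L\ge W_K+{}$drift of $[0,L)$; on the
renovation event the erasing words leave a surplus of 2. If the mean drift were non-negative,
$\mathbb E W_{jL}$ would grow at least like $j$. But renovation keeps $W_K$ bounded uniformly in $K$
off a small event, and $W_K\le 2K$ everywhere, so it grows more slowly: a contradiction. -/

/-- The difference of the indicators of `I` and of its neighbourhood. -/
noncomputable def weight (G : SimpleGraph V) (I : Set V) (v : V) : ℝ :=
  I.indicator 1 v - (neighbors G I).indicator 1 v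

/-- The total weight of a word. -/
noncomputable def wordWeight (G : SimpleGraph V) (I : Set V) (l : List V) : ℝ :=
  (l.map (weight G I)).sum

theorem abs_weight_le_one (I : Set V) (v : V) : |weight G I v| ≤ 1 := by
  classical
  simp only [weight, Set.indicator_apply, Pi.one_apply]
  split_ifs <;> norm_num

/-- An endpoint in `I` puts the other endpoint in the neighbourhood, so every $+1$ is paid for by a
$-1$. -/
theorem weight_add_weight_nonpos (I : Set V) {u v : V} (h : G.Adj u v) :
    weight G I u + weight G I v ≤ 0 := by
  classical
  have h₁ : u ∈ I → v ∈ neighbors G I := fun hu => ⟨u, hu, h⟩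
  have h₂ : v ∈ I → u ∈ neighbors G I := fun hv => ⟨v, hv, h.symm⟩
  simp only [weight, Set.indicator_apply, Pi.one_apply]
  split_ifs <;> first | (exfalso; tauto) | norm_num

theorem weight_eq_one_of_mem {I : Set V} (hI : G.IsIndepSet I) {v : V} (hv : v ∈ I) :
    weight G I v = 1 := by
  have h : v ∉ neighbors G I := fun ⟨u, hu, huv⟩ => hI hu hv huv.ne huv
  simp [weight, hv, h]

theorem wordWeight_append (I : Set V) (l l' : List V) :
    wordWeight G I (l ++ l') = wordWeight G I l + wordWeight G I l' := by
  simp [wordWeight]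

theorem neg_length_le_wordWeight (I : Set V) (l : List V) :
    -(l.length : ℝ) ≤ wordWeight G I l := by
  induction l with
  | nil => simp [wordWeight]
  | cons a l ih =>
    have := (abs_le.1 (abs_weight_le_one (G := G) I a)).1
    simp only [wordWeight, List.map_cons, List.sum_cons, List.length_cons] at ih ⊢
    push_cast
    linarith

theorem wordWeight_eraseIdx (I : Set V) (l : List V) (k : Fin l.length) :
    wordWeight G I (l.eraseIdx k) = wordWeight G I l - weight G I (l.get k) := by
  have h := (List.getElem_cons_eraseIdx_perm (l := l) k.2).map (weight G I)
  have := h.sum_eq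
  simp only [List.map_cons, List.sum_cons] at this
  simp only [wordWeight, List.get_eq_getElem]
  linarith

/-- Storage gives equality; a match deletes a compatible pair, whose weight is non-positive. The
rule that picks the match plays no role. -/
theorem AdmissiblePolicy.le_wordWeight_step (φ : AdmissiblePolicy G) (I : Set V)
    (w : QueueDetail G) (a : V × PreferenceList G) :
    wordWeight G I w.word + weight G I a.1 ≤ wordWeight G I (φ.step w a).word := by
  unfold AdmissiblePolicy.step
  split_ifs with h
  · have := weight_add_weight_nonpos I (φ.choice w a.1 a.2 h).2
    simp only [wordWeight_eraseIdx]
    linarith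
  · simp [wordWeight]

theorem AdmissiblePolicy.le_wordWeight_foldl (φ : AdmissiblePolicy G) (I : Set V)
    (l : List (V × PreferenceList G)) (w : QueueDetail G) :
    wordWeight G I w.word + wordWeight G I (l.map Prod.fst) ≤
      wordWeight G I (l.foldl φ.step w).word := by
  induction l generalizing w with
  | nil => simp [wordWeight]
  | cons a l ih =>
    have h₁ := ih (φ.step w a)
    have h₂ := φ.le_wordWeight_step I w a
    simp only [wordWeight, List.map_cons, List.sum_cons, List.foldl_cons] at h₁ h₂ ⊢
    linarith

/-- A strong erasing word has weight at most `-2`. -/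
theorem IsStrongErasingWord.wordWeight_le {φ : AdmissiblePolicy G} {z : List V}
    (hz : IsStrongErasingWord φ z) {I : Set V} (hI : I ∈ independentSets G) :
    wordWeight G I z ≤ -2 := by
  obtain ⟨⟨i, hi⟩, hind⟩ := hI
  obtain ⟨σ, hσ⟩ := φ.prefLaw.support_nonempty
  -- Taking $i=j\in I$, with one constant list of preferences of positive probability, gives
  -- $2+f(z)\le 0$.
  have he := hz.erases i i (G.irrefl) (List.replicate (z.length + 2) σ) (by simp)
    (fun τ hτ => (List.eq_of_mem_replicate hτ) ▸ hσ)
  have h := φ.le_wordWeight_foldl I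
    ((i :: i :: z).zip (List.replicate (z.length + 2) σ)) (QueueDetail.empty G)
  rw [AdmissiblePolicy.queue] at he
  rw [he, List.map_fst_zip (by simp)] at h
  simp only [wordWeight, QueueDetail.empty, List.map_nil, List.sum_nil, List.map_cons,
    List.sum_cons, weight_eq_one_of_mem hind hi] at h ⊢
  linarith

theorem wordWeight_flatten_le {φ : AdmissiblePolicy G} {I : Set V} (hI : I ∈ independentSets G)
    (L : List (List V)) (hL : ∀ z ∈ L, IsStrongErasingWord φ z) :
    wordWeight G I L.flatten ≤ -2 * (L.length : ℝ) := by
  induction L with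
  | nil => simp [wordWeight]
  | cons z L ih =>
    have h₁ := (hL z (by simp)).wordWeight_le hI
    have h₂ := ih fun y hy => hL y (by simp [hy])
    rw [List.flatten_cons, wordWeight_append, List.length_cons]
    push_cast
    linarith

end Weight

/-! ### Drift of the input -/

section Drift

variable {V : Type*} {G : SimpleGraph V}

/-- The weight of a pair of arrivals. -/
noncomputable def pairWeight (I : Set V) (p : Pair G) : ℝ :=
  weight G I p.1 + weight G I p.2.2.1

/-- The total weight of the `t` pairs of arrivals from time `a` on. -/
noncomputable def drift (I : Set V) (a : ℤ) (t : ℕ) (ω : PairedInput G) : ℝ :=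
  ∑ i ∈ Finset.range t, pairWeight I (ω (a + i))

/-- The maximum of the drifts over the windows of length at most `K` which end at time `0`. -/
noncomputable def maxDrift (I : Set V) (K : ℕ) (ω : PairedInput G) : ℝ :=
  (Finset.range (K + 1)).sup' Finset.nonempty_range_add_one fun k => drift I (-(k : ℤ)) k ω

theorem shift_shift (k l : ℤ) (ω : PairedInput G) :
    shift k (shift l ω) = shift (k + l) ω := by
  funext n
  simp [shift, add_assoc]

theorem shift_zero (ω : PairedInput G) : shift 0 ω = ω := by
  funext n
  simp [shift]

theorem mem_image_shift {k : ℤ} {A : Set (PairedInput G)} {ω : PairedInput G} :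
    ω ∈ shift k '' A ↔ shift (-k) ω ∈ A := by
  constructor
  · rintro ⟨ω, hω, rfl⟩
    simpa [shift_shift, shift_zero] using hω
  · exact fun h => ⟨_, h, by simp [shift_shift, shift_zero]⟩

theorem drift_shift (I : Set V) (a k : ℤ) (t : ℕ) (ω : PairedInput G) :
    drift I a t (shift k ω) = drift I (a + k) t ω := by
  simp only [drift, shift]
  refine Finset.sum_congr rfl fun i _ => ?_
  congr 2
  ring

theorem drift_add (I : Set V) (a : ℤ) (s t : ℕ) (ω : PairedInput G) :
    drift I a (s + t) ω = drift I a s ω + drift I (a + s) t ω := by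
  simp only [drift, Finset.sum_range_add]
  congr 1
  refine Finset.sum_congr rfl fun i _ => ?_
  congr 2
  push_cast
  ring

theorem abs_pairWeight_le (I : Set V) (p : Pair G) : |pairWeight I p| ≤ 2 := by
  have h₁ := abs_weight_le_one (G := G) I p.1
  have h₂ := abs_weight_le_one (G := G) I p.2.2.1
  exact (abs_add_le _ _).trans (by linarith)

theorem abs_drift_le (I : Set V) (a : ℤ) (t : ℕ) (ω : PairedInput G) :
    |drift I a t ω| ≤ 2 * t := by
  refine (Finset.abs_sum_le_sum_abs _ _).trans ?_
  refine (Finset.sum_le_sum fun i _ => abs_pairWeight_le I _).trans ?_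
  simp [mul_comm]

theorem drift_le_maxDrift (I : Set V) {k K : ℕ} (h : k ≤ K) (ω : PairedInput G) :
    drift I (-(k : ℤ)) k ω ≤ maxDrift I K ω :=
  Finset.le_sup' (fun k : ℕ => drift I (-(k : ℤ)) k ω) (Finset.mem_range.2 (by omega))

theorem exists_maxDrift_eq (I : Set V) (K : ℕ) (ω : PairedInput G) :
    ∃ k ≤ K, maxDrift I K ω = drift I (-(k : ℤ)) k ω := by
  obtain ⟨k, hk, h⟩ := Finset.exists_mem_eq_sup' Finset.nonempty_range_add_one
    (s := Finset.range (K + 1)) fun k : ℕ => drift I (-(k : ℤ)) k ω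
  exact ⟨k, by simpa [Nat.lt_succ_iff] using hk, h⟩

theorem maxDrift_nonneg (I : Set V) (K : ℕ) (ω : PairedInput G) : 0 ≤ maxDrift I K ω := by
  simpa [drift] using drift_le_maxDrift I (Nat.zero_le K) ω

theorem maxDrift_le (I : Set V) (K : ℕ) (ω : PairedInput G) : maxDrift I K ω ≤ 2 * K := by
  obtain ⟨k, hk, h⟩ := exists_maxDrift_eq I K ω
  rw [h]
  refine (le_abs_self _).trans ((abs_drift_le _ _ _ _).trans ?_)
  have : (k : ℝ) ≤ K := by exact_mod_cast hk
  linarith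

/-- A window optimal at time 0, prolonged by the next `L` pairs, competes in the maximum at time
`L`. -/
theorem drift_add_maxDrift_le (I : Set V) (K L : ℕ) (ω : PairedInput G) :
    drift I 0 L ω + maxDrift I K ω ≤ maxDrift I (K + L) (shift L ω) := by
  obtain ⟨k, hk, h⟩ := exists_maxDrift_eq I K ω
  have h₁ := drift_le_maxDrift I (show k + L ≤ K + L by omega) (shift L ω)
  rw [drift_shift, drift_add] at h₁
  have e₁ : -((k + L : ℕ) : ℤ) + L = -k := by push_cast; ring
  rw [e₁] at h₁
  simp only [neg_add_cancel] at h₁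
  linarith

theorem wordWeight_arrivalWord (I : Set V) (m : ℕ) (ω : PairedInput G) :
    wordWeight G I (arrivalWord m ω) = drift I 0 m ω := by
  induction m with
  | zero => simp [arrivalWord, wordWeight, drift]
  | succ m ih =>
    have : arrivalWord (m + 1) ω = arrivalWord m ω ++ [(ω m).1, (ω m).2.2.1] := by
      simp [arrivalWord, List.range_succ]
    rw [this, wordWeight_append, ih, drift_add]
    simp [wordWeight, drift, pairWeight]

theorem le_wordWeight_evenBuffer (φ : AdmissiblePolicy G) (Y : PairedInput G → QueueDetail G)
    (I : Set V) (n : ℕ) (ω : PairedInput G) :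
    wordWeight G I (Y ω).word + drift I 0 n ω ≤ wordWeight G I (evenBuffer φ Y n ω).word := by
  induction n with
  | zero => simp [drift, evenBuffer]
  | succ n ih =>
    have h₁ := φ.le_wordWeight_step I (evenBuffer φ Y n ω) ((ω n).1, (ω n).2.1)
    have h₂ := φ.le_wordWeight_step I
      (φ.step (evenBuffer φ Y n ω) ((ω n).1, (ω n).2.1)) ((ω n).2.2.1, (ω n).2.2.2)
    rw [drift_add]
    simp only [evenBuffer]
    simp only [drift, Finset.sum_range_one, pairWeight, zero_add, Nat.cast_zero, add_zero] at *
    linarith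

/-- The event says that the system started at time $-k$ from $Y\circ\theta^{-k}$ is empty at time
$l$, so the window $[-k,l)$ cannot outweigh minus the initial content. -/
theorem drift_le_of_mem_shift_emptyEvent {φ : AdmissiblePolicy G}
    {Y : PairedInput G → QueueDetail G} (I : Set V) {k l : ℕ} {ω : PairedInput G}
    (h : ω ∈ shift (k : ℤ) '' emptyEvent φ Y (l + k)) :
    drift I (-(k : ℤ)) k ω + drift I 0 l ω ≤ -wordWeight G I (Y (shift (-(k : ℤ)) ω)).word := by
  rw [mem_image_shift] at h
  have h₁ := le_wordWeight_evenBuffer φ Y I (l + k) (shift (-(k : ℤ)) ω)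
  have h₂ : evenBuffer φ Y (l + k) (shift (-(k : ℤ)) ω) = QueueDetail.empty G := h
  rw [h₂, drift_shift, add_comm l k, drift_add] at h₁
  simp only [zero_add, neg_add_cancel] at h₁
  have h₃ : wordWeight G I (QueueDetail.empty G).word = 0 := by
    simp [wordWeight, QueueDetail.empty]
  linarith

theorem drift_le_of_mem_shift_arrivalEvent {φ : AdmissiblePolicy G} {I : Set V}
    (hI : I ∈ independentSets G) {r : ℕ} (hr : 0 < r) {z : Fin r → List V}
    (hz : ∀ i, IsStrongErasingWord φ (z i)) {l : ℕ} {ω : PairedInput G}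
    (h : ω ∈ shift (-(l : ℤ)) '' arrivalEvent G z) :
    drift I l ((∑ i, (z i).length) / 2) ω ≤ -2 := by
  rw [mem_image_shift, neg_neg] at h
  have h₁ : arrivalWord _ _ = _ := h
  have h₂ := wordWeight_arrivalWord I ((∑ i, (z i).length) / 2) (shift l ω)
  rw [h₁, drift_shift, zero_add] at h₂
  have h₃ := wordWeight_flatten_le hI (List.ofFn z)
    (by simpa [List.forall_mem_ofFn_iff] using hz)
  rw [List.length_ofFn] at h₃
  have h₄ : (1 : ℝ) ≤ r := by exact_mod_cast hr
  linarith

/-- If every past window is compensated, within `n` steps, by a window of arrivals followed by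
a block of weight at most `-2`, then the maximal drift is bounded and gains `2` over the
mere addition of the arrivals. -/
theorem maxDrift_of_compensated {I : Set V} {n m : ℕ} {ω : PairedInput G}
    (h : ∀ k : ℕ, ∃ l ≤ n, drift I (-(k : ℤ)) k ω + drift I 0 l ω ≤ 0 ∧ drift I l m ω ≤ -2)
    (K : ℕ) :
    maxDrift I K ω ≤ 2 * (n + m : ℕ) ∧
      drift I 0 (n + m) ω + maxDrift I K ω + 2 ≤
        maxDrift I (K + (n + m)) (shift (n + m : ℕ) ω) := by
  -- Compensation is applied to the window achieving the maximum.
  obtain ⟨k, -, hk⟩ := exists_maxDrift_eq I K ω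
  obtain ⟨l, hl, h₁, h₂⟩ := h k
  have h₃ : drift I 0 (l + m) ω ≤ -2 - maxDrift I K ω := by
    rw [drift_add, zero_add]
    linarith
  have h₄ := (abs_le.1 (abs_drift_le I 0 (l + m) ω)).1
  have h₅ : ((l + m : ℕ) : ℝ) ≤ (n + m : ℕ) := by exact_mod_cast (by omega)
  refine ⟨by linarith, ?_⟩
  -- The competing window at time $n+m$ is what remains after the erasing block, $[l+m,n+m)$, of
  -- length $n-l$.
  have h₆ := drift_le_maxDrift I (show n - l ≤ K + (n + m) by omega) (shift (n + m : ℕ) ω)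
  rw [drift_shift] at h₆
  have h₇ := drift_add I 0 (l + m) (n - l) ω
  rw [show l + m + (n - l) = n + m by omega] at h₇
  rw [show -((n - l : ℕ) : ℤ) + (n + m : ℕ) = 0 + (l + m : ℕ) by omega] at h₆
  linarith

end Drift

/-! ### Integration against a stationary law -/

section Stationary

variable {V : Type*} {G : SimpleGraph V} [MeasurableSpace V]

theorem measurable_shift (k : ℤ) : Measurable (shift (G := G) k) :=
  measurable_pi_lambda _ fun _ => measurable_pi_apply _

variable {P : Measure (PairedInput G)}

theorem measurePreserving_shift (h : MeasurePreserving (shift 1) P P) (k : ℤ) :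
    MeasurePreserving (shift k) P P := by
  have hnat : ∀ n : ℕ, MeasurePreserving (shift (n : ℤ)) P P := by
    intro n
    induction n with
    | zero =>
      rw [show shift ((0 : ℕ) : ℤ) = (id : PairedInput G → PairedInput G) from
        funext fun ω => shift_zero ω]
      exact MeasurePreserving.id P
    | succ n ih =>
      rw [show shift ((n + 1 : ℕ) : ℤ) = shift (n : ℤ) ∘ (shift (1 : ℤ) : PairedInput G → _) from
        funext fun ω => (by simp [shift_shift])]
      exact ih.comp h
  obtain ⟨n, rfl | rfl⟩ := k.eq_nat_or_neg
  · exact hnat n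
  -- A negative shift inverts a positive one, under which the law is already invariant.
  · refine ⟨measurable_shift _, ?_⟩
    conv_lhs => rw [← (hnat n).map_eq]
    rw [Measure.map_map (measurable_shift _) (measurable_shift _)]
    rw [show shift (-(n : ℤ)) ∘ shift (n : ℤ) = (id : PairedInput G → PairedInput G) from
      funext fun ω => (by simp [shift_shift, shift_zero])]
    exact Measure.map_id

variable [Finite V] [MeasurableSingletonClass V]

theorem measurable_pairWeight (I : Set V) : Measurable (pairWeight (G := G) I) := by
  have h : Measurable (weight G I) := measurable_of_finite _
  unfold pairWeight
  fun_prop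

theorem measurable_drift (I : Set V) (a : ℤ) (t : ℕ) : Measurable (drift (G := G) I a t) := by
  unfold drift
  exact Finset.measurable_sum _ fun i _ => (measurable_pairWeight I).comp (measurable_pi_apply _)

theorem measurable_maxDrift (I : Set V) (K : ℕ) : Measurable (maxDrift (G := G) I K) := by
  have h := Finset.measurable_sup' (s := Finset.range (K + 1)) Finset.nonempty_range_add_one
    (f := fun (k : ℕ) (ω : PairedInput G) => drift I (-(k : ℤ)) k ω)
    fun k _ => measurable_drift I _ _
  convert h using 1
  funext ω
  simp [maxDrift, Finset.sup'_apply]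

variable [IsProbabilityMeasure P]

theorem integrable_drift (I : Set V) (a : ℤ) (t : ℕ) : Integrable (drift I a t) P :=
  Integrable.of_bound (measurable_drift I a t).aestronglyMeasurable (2 * t)
    (ae_of_all _ fun ω => abs_drift_le I a t ω)

theorem integrable_maxDrift (I : Set V) (K : ℕ) : Integrable (maxDrift I K) P :=
  Integrable.of_bound (measurable_maxDrift I K).aestronglyMeasurable (2 * K)
    (ae_of_all _ fun ω => by
      rw [Real.norm_of_nonneg (maxDrift_nonneg I K ω)]
      exact maxDrift_le I K ω)

theorem integral_drift (h : MeasurePreserving (shift 1) P P) (I : Set V) (a : ℤ) (t : ℕ) :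
    ∫ ω, drift I a t ω ∂P = t * ∫ ω, drift I 0 1 ω ∂P := by
  have hone : ∀ k : ℤ, ∫ ω, drift I k 1 ω ∂P = ∫ ω, drift I 0 1 ω ∂P := by
    intro k
    have hk := measurePreserving_shift h k
    have := integral_map (μ := P) hk.measurable.aemeasurable
      (measurable_drift (G := G) I 0 1).aestronglyMeasurable
    rw [hk.map_eq] at this
    simpa [drift_shift] using this.symm
  induction t with
  | zero => simp [drift]
  | succ t ih =>
    simp only [drift_add I a t 1]
    rw [integral_add (integrable_drift I _ _) (integrable_drift I _ _), ih, hone (a + t)]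
    push_cast
    ring

/-- A variable bounded by `B`, and by `C` outside of an event of probability `ε`, has
expectation at most `C + B ε`. -/
theorem integral_le_of_bound_off {α : Type*} [MeasurableSpace α] {Q : Measure α}
    [IsProbabilityMeasure Q] {f : α → ℝ} (hf : Measurable f) (hi : Integrable f Q)
    {B C ε : ℝ} (hB : 0 ≤ B) (hC : 0 ≤ C) (hle : ∀ x, f x ≤ B) (hQ : Q.real {x | C < f x} ≤ ε) :
    ∫ x, f x ∂Q ≤ C + B * ε := by
  have hs : MeasurableSet {x | C < f x} := measurableSet_lt measurable_const hf
  have h₁ : Integrable ({x | C < f x}.indicator fun _ => B) Q :=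
    (integrable_const B).indicator hs
  have h₂ : ∫ x, f x ∂Q ≤ ∫ x, (C + {x | C < f x}.indicator (fun _ => B) x) ∂Q := by
    refine integral_mono hi ((integrable_const C).add h₁) fun x => ?_
    by_cases hx : C < f x
    · have := hle x
      simp only [Set.indicator, Set.mem_ofPred_eq, hx, if_true]
      linarith
    · simp only [Set.indicator, Set.mem_ofPred_eq, hx, if_false]
      linarith
  rw [integral_add (integrable_const C) h₁, integral_indicator_const _ hs] at h₂
  simp only [integral_const, probReal_univ, smul_eq_mul, one_mul] at h₂
  nlinarith [mul_le_mul_of_nonneg_left hQ hB]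

/-- If the events `E n` have probabilities tending to `1`, one of them has probability more
than `1 - ε`, and so have the events which contain it. -/
theorem exists_real_compl_lt {α : Type*} [MeasurableSpace α] {Q : Measure α}
    [IsProbabilityMeasure Q] {E : ℕ → Set α} (hE : Tendsto (fun n => Q (E n)) atTop (𝓝 1))
    {ε : ℝ} (hε : 0 < ε) :
    ∃ n, ∀ F : Set α, MeasurableSet F → E n ⊆ F → Q.real Fᶜ < ε := by
  have h : Tendsto (fun n => Q.real (E n)) atTop (𝓝 1) := by
    exact (ENNReal.tendsto_toReal ENNReal.one_ne_top).comp hE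
  obtain ⟨n, hn⟩ := (h.eventually (lt_mem_nhds (show 1 - ε < 1 by linarith))).exists
  refine ⟨n, fun F hF hEF => ?_⟩
  -- Monotonicity needs measurability of `F` only, so that of the renovation events is never
  -- required.
  have := measureReal_mono (μ := Q) hEF
  rw [probReal_compl_eq_one_sub hF]
  linarith

/-- Under the renovation condition, the drift has non-positive mean. -/
theorem RenovationCondition.integral_drift_nonpos {φ : AdmissiblePolicy G}
    {Y : PairedInput G → QueueDetail G} (hR : RenovationCondition φ P Y) (hY : Measurable Y)
    (h : MeasurePreserving (shift 1) P P) (I : Set V) :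
    ∫ ω, drift I 0 1 ω ∂P ≤ 0 := by
  by_contra! hc
  set c := ∫ ω, drift I 0 1 ω ∂P
  have hlen : Measurable fun ω => (Y ω).word.length :=
    (measurable_from_top (f := fun w : QueueDetail G => w.word.length)).comp hY
  obtain ⟨n, hn⟩ := exists_real_compl_lt hR (show 0 < c / 8 by linarith)
  have hYlim : Tendsto (fun M : ℕ => P {ω | (Y ω).word.length ≤ M}) atTop (𝓝 1) := by
    have hmono : Monotone fun M : ℕ => {ω : PairedInput G | (Y ω).word.length ≤ M} :=
      fun M N hMN ω hω => le_trans hω hMN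
    have := tendsto_measure_iUnion_atTop (μ := P) hmono
    rwa [show ⋃ M : ℕ, {ω : PairedInput G | (Y ω).word.length ≤ M} = Set.univ from
      Set.eq_univ_of_forall fun ω => Set.mem_iUnion.2 ⟨(Y ω).word.length, le_refl (Y ω).word.length⟩, measure_univ] at this
  obtain ⟨M, hM⟩ := exists_real_compl_lt hYlim (show 0 < c / 8 by linarith)
  have hMset : MeasurableSet {ω | (Y ω).word.length ≤ M} := measurableSet_le hlen measurable_const
  -- Two exceptional events of probability below $c/8$ (no renovation, or a long initial content)
  -- leave total mass at most $c/4$, where the drift is at most $2k$. The slope on the right is then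
  -- $c/2<c$.
  have hkey : ∀ k : ℕ, k * c ≤ (M + 2 * n : ℝ) + 2 * k * (c / 4) := by
    intro k
    rw [← integral_drift h I (-(k : ℤ)) k]
    have hk := measurePreserving_shift h (-(k : ℤ))
    refine integral_le_of_bound_off (measurable_drift I _ _) (integrable_drift I _ _)
      (by positivity) (by positivity) (fun ω => (le_abs_self _).trans (abs_drift_le I _ _ ω)) ?_
    set F : Set (PairedInput G) := {ω | drift I (-(k : ℤ)) k ω ≤
      (Y (shift (-(k : ℤ)) ω)).word.length + 2 * n} with hFdef
    have hF : MeasurableSet F := by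
      refine measurableSet_le (measurable_drift I _ _) (Measurable.add_const ?_ _)
      exact (measurable_from_top (f := fun m : ℕ => (m : ℝ))).comp (hlen.comp hk.measurable)
    have h₁ := hn F hF (fun ω hω => by
      obtain ⟨l, hω⟩ := Set.mem_iUnion.1 (Set.mem_iInter.1 hω k)
      obtain ⟨hl, -, hω⟩ := Set.mem_iUnion.1 hω
      have a₁ := drift_le_of_mem_shift_emptyEvent I hω
      have a₂ := neg_length_le_wordWeight (G := G) I (Y (shift (-(k : ℤ)) ω)).word
      have a₃ := (abs_le.1 (abs_drift_le I 0 l ω)).1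
      have a₄ : (l : ℝ) ≤ n := by exact_mod_cast hl
      simp only [hFdef, Set.mem_ofPred_eq]
      linarith)
    have h₂ := hM _ hMset subset_rfl
    have h₃ : P.real (shift (-(k : ℤ)) ⁻¹' {ω | (Y ω).word.length ≤ M}ᶜ) < c / 8 := by
      rwa [hk.measureReal_preimage hMset.compl.nullMeasurableSet]
    have h₄ : {ω | (M + 2 * n : ℝ) < drift I (-(k : ℤ)) k ω} ⊆
        Fᶜ ∪ shift (-(k : ℤ)) ⁻¹' {ω | (Y ω).word.length ≤ M}ᶜ := by
      intro ω hω
      by_contra hcon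
      simp only [hFdef, Set.mem_union, Set.mem_compl_iff, Set.mem_preimage, Set.mem_ofPred_eq,
        not_or, not_not] at hcon hω
      have : ((Y (shift (-(k : ℤ)) ω)).word.length : ℝ) ≤ M := by exact_mod_cast hcon.2
      linarith [hcon.1]
    linarith [measureReal_mono (μ := P) h₄, measureReal_union_le (μ := P) Fᶜ
      (shift (-(k : ℤ)) ⁻¹' {ω | (Y ω).word.length ≤ M}ᶜ)]
  obtain ⟨k, hk⟩ := exists_nat_gt ((M + 2 * n : ℝ) * 2 / c)
  rw [div_lt_iff₀ hc] at hk
  linarith [hkey k]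

/-- Under the erasing renovation condition for strong erasing words, the drift has negative
mean. -/
theorem ErasingRenovationCondition.integral_drift_neg {φ : AdmissiblePolicy G} {r : ℕ}
    {z : Fin r → List V} (hR : ErasingRenovationCondition φ P z) (hr : 0 < r)
    (hz : ∀ i, IsStrongErasingWord φ (z i)) (h : MeasurePreserving (shift 1) P P) {I : Set V}
    (hI : I ∈ independentSets G) :
    ∫ ω, drift I 0 1 ω ∂P < 0 := by
  by_contra! hc
  set m := (∑ i, (z i).length) / 2
  have hcomp : ∀ n ω, (ω ∈ ⋂ k : ℕ, ⋃ l : ℕ, ⋃ _ : l ≤ n,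
      emptyEvent φ (fun _ => QueueDetail.empty G) l ∩
        shift (k : ℤ) '' emptyEvent φ (fun _ => QueueDetail.empty G) (l + k) ∩
        shift (-(l : ℤ)) '' arrivalEvent G z) →
      ∀ k : ℕ, ∃ l ≤ n, drift I (-(k : ℤ)) k ω + drift I 0 l ω ≤ 0 ∧ drift I l m ω ≤ -2 := by
    intro n ω hω k
    obtain ⟨l, hω⟩ := Set.mem_iUnion.1 (Set.mem_iInter.1 hω k)
    obtain ⟨hl, ⟨-, h₁⟩, h₂⟩ := Set.mem_iUnion.1 hω
    refine ⟨l, hl, ?_, drift_le_of_mem_shift_arrivalEvent hI hr hz h₂⟩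
    simpa [wordWeight, QueueDetail.empty] using drift_le_of_mem_shift_emptyEvent I h₁
  -- Probability above $1/2$ turns the surplus 2 into a mean gain of at least 1 for each block of
  -- length `L`.
  obtain ⟨n, hn⟩ := exists_real_compl_lt hR (show (0 : ℝ) < 1 / 2 by norm_num)
  set L := n + m
  have hgain : ∀ K : ℕ, ∫ ω, maxDrift I K ω ∂P + 1 ≤ ∫ ω, maxDrift I (K + L) ω ∂P := by
    intro K
    have hpres := measurePreserving_shift h (L : ℤ)
    set F : Set (PairedInput G) :=
      {ω | drift I 0 L ω + maxDrift I K ω + 2 ≤ maxDrift I (K + L) (shift (L : ℤ) ω)} with hFdef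
    have hF : MeasurableSet F :=
      measurableSet_le (((measurable_drift I 0 L).add (measurable_maxDrift I K)).add_const 2)
        ((measurable_maxDrift I (K + L)).comp hpres.measurable)
    have h₁ := hn F hF fun ω hω => (maxDrift_of_compensated (hcomp n ω hω) K).2
    rw [probReal_compl_eq_one_sub hF] at h₁
    have hint : Integrable (F.indicator fun _ => (2 : ℝ)) P := (integrable_const _).indicator hF
    have hD : Integrable (drift I 0 L) P := integrable_drift I 0 L
    have hW : Integrable (maxDrift I K) P := integrable_maxDrift I K
    have h₂ : ∫ ω, (drift I 0 L ω + maxDrift I K ω + F.indicator (fun _ => (2 : ℝ)) ω) ∂P ≤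
        ∫ ω, maxDrift I (K + L) (shift (L : ℤ) ω) ∂P := by
      refine integral_mono ((hD.add hW).add hint)
        (hpres.integrable_comp_of_integrable (integrable_maxDrift I (K + L))) fun ω => ?_
      by_cases hω : ω ∈ F
      · simpa only [Set.indicator_of_mem hω] using hω.out
      · simpa [hω] using drift_add_maxDrift_le I K L ω
    have h₃ := integral_map (μ := P) hpres.measurable.aemeasurable
      (measurable_maxDrift (G := G) I (K + L)).aestronglyMeasurable
    rw [hpres.map_eq] at h₃
    have h₅ : ∫ ω, (drift I 0 L ω + maxDrift I K ω + F.indicator (fun _ => (2 : ℝ)) ω) ∂P =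
        ∫ ω, (drift I 0 L ω + maxDrift I K ω) ∂P + ∫ ω, F.indicator (fun _ => (2 : ℝ)) ω ∂P :=
      integral_add (hD.add hW) hint
    rw [h₅, integral_add hD hW, integral_indicator_const _ hF,
      integral_drift h, ← h₃, smul_eq_mul] at h₂
    -- The assumption for contradiction, a non-negative mean drift, enters here.
    have h₄ : 0 ≤ (L : ℝ) * ∫ ω, drift I 0 1 ω ∂P := by positivity
    linarith
  have hgrow : ∀ j : ℕ, (j : ℝ) ≤ ∫ ω, maxDrift I (j * L) ω ∂P := by
    intro j
    induction j with
    | zero => simpa using integral_nonneg fun ω => maxDrift_nonneg I _ ω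
    | succ j ih =>
      have := hgain (j * L)
      rw [← Nat.succ_mul] at this
      push_cast
      linarith
  have hLpos : (0 : ℝ) < L + 1 := by positivity
  -- With `L` now fixed, renovation is invoked again at a precision depending on `L`, so that the
  -- bound $2jL$ on the exceptional event contributes at most $j/2$.
  obtain ⟨n', hn'⟩ := exists_real_compl_lt hR (show (0 : ℝ) < 1 / (4 * (L + 1)) by positivity)
  have hbound : ∀ j : ℕ, (j : ℝ) ≤ 2 * (n' + m : ℕ) + 2 * (j * L : ℕ) * (1 / (4 * (L + 1))) := by
    intro j
    refine (hgrow j).trans (integral_le_of_bound_off (measurable_maxDrift I _)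
      (integrable_maxDrift I _) (by positivity) (by positivity) (maxDrift_le I _) ?_)
    have := hn' {ω | maxDrift I (j * L) ω ≤ 2 * (n' + m : ℕ)}
      (measurableSet_le (measurable_maxDrift I _) measurable_const)
      fun ω hω => (maxDrift_of_compensated (hcomp n' ω hω) (j * L)).1
    simpa [Set.compl_ofPred] using this.le
  obtain ⟨j, hj⟩ := exists_nat_gt (4 * (n' + m : ℕ) : ℝ)
  have h₁ := hbound j
  have h₂ : 2 * ((j * L : ℕ) : ℝ) * (1 / (4 * (L + 1))) ≤ j / 2 := by
    rw [mul_one_div, div_le_div_iff₀ (by positivity) (by norm_num)]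
    push_cast
    nlinarith [Nat.cast_nonneg (α := ℝ) j]
  linarith

end Stationary

/-! ### The law of the input -/

section Input

variable {V : Type*} [MeasurableSpace V] {G : SimpleGraph V} {φ : AdmissiblePolicy G}
  {Ω : Type*} [MeasurableSpace Ω] {ℙ : Measure Ω} {X : ℤ → Ω → V}
  {S : ℤ → Ω → PreferenceList G} {μ₀ μ₁ : Measure V}

theorem StationaryErgodicPairedInput.measurable_pairing
    (h : StationaryErgodicPairedInput φ ℙ X S μ₀ μ₁) : Measurable (pairing X S) :=
  measurable_pi_lambda _ fun n => (h.measurable_class (2 * n)).prodMk <|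
    (h.measurable_pref (2 * n)).prodMk <|
      (h.measurable_class (2 * n + 1)).prodMk (h.measurable_pref (2 * n + 1))

variable [Finite V] [MeasurableSingletonClass V]

theorem integral_weight (μ : Measure V) [IsFiniteMeasure μ] (I : Set V) :
    ∫ v, weight G I v ∂μ = μ.real I - μ.real (neighbors G I) := by
  have hI : MeasurableSet I := I.toFinite.measurableSet
  have hE : MeasurableSet (neighbors G I) := (Set.toFinite _).measurableSet
  unfold weight
  rw [integral_sub (Integrable.of_finite) (Integrable.of_finite),
    integral_indicator_one hI, integral_indicator_one hE]

/-- The factor 2 appears because a pair contributes one arrival of each law, while the average law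
halves their sum. -/
theorem StationaryErgodicPairedInput.integral_drift_palmLaw [IsProbabilityMeasure ℙ]
    (h : StationaryErgodicPairedInput φ ℙ X S μ₀ μ₁) (I : Set V) :
    ∫ ω, drift I 0 1 ω ∂(palmLaw ℙ X S) =
      2 * ((averageLaw μ₀ μ₁).real I - (averageLaw μ₀ μ₁).real (neighbors G I)) := by
  have hw : Measurable (weight G I) := measurable_of_finite _
  have h₀ := h.first_marginal 0
  have h₁ := h.third_marginal 0
  have m₀ := h.measurable_class (2 * 0)
  have m₁ := h.measurable_class (2 * 0 + 1)
  have : IsProbabilityMeasure μ₀ := h₀ ▸ Measure.isProbabilityMeasure_map m₀.aemeasurable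
  have : IsProbabilityMeasure μ₁ := h₁ ▸ Measure.isProbabilityMeasure_map m₁.aemeasurable
  have hi : ∀ n, Integrable (fun x => weight G I (X n x)) ℙ := fun n =>
    Integrable.of_bound (hw.comp (h.measurable_class n)).aestronglyMeasurable 1
      (ae_of_all _ fun x => abs_weight_le_one I _)
  have havg : ∀ A, (averageLaw μ₀ μ₁).real A = 2⁻¹ * (μ₀.real A + μ₁.real A) := fun A => by
    rw [averageLaw, measureReal_ennreal_smul_apply, measureReal_add_apply]
    simp
  rw [palmLaw, integral_map h.measurable_pairing.aemeasurable
    (measurable_drift I 0 1).aestronglyMeasurable]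
  have e : ∀ x, drift I 0 1 (pairing X S x) =
      weight G I (X (2 * 0) x) + weight G I (X (2 * 0 + 1) x) := fun x => by
    simp [drift, pairWeight, pairing]
  simp only [e]
  rw [integral_add (hi _) (hi _), ← integral_map m₀.aemeasurable hw.aestronglyMeasurable,
    ← integral_map m₁.aemeasurable hw.aestronglyMeasurable, h₀, h₁, integral_weight,
    integral_weight, havg, havg]
  ring

end Input

end GeneralMatching

theorem mainTheorem10 {V : Type*} [Fintype V] [MeasurableSpace V] [MeasurableSingletonClass V]
    (G : SimpleGraph V) (hG : G.Connected) (φ : GeneralMatching.AdmissiblePolicy G)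
    {Ω : Type*} [MeasurableSpace Ω] (ℙ : Measure Ω) [IsProbabilityMeasure ℙ]
    (X : ℤ → Ω → V) (S : ℤ → Ω → GeneralMatching.PreferenceList G) (μ₀ μ₁ : Measure V)
    (hinput : GeneralMatching.StationaryErgodicPairedInput φ ℙ X S μ₀ μ₁) :
    (∀ (r : ℕ) (z : Fin r → List V), 0 < r →
      (∀ i, GeneralMatching.IsStrongErasingWord φ (z i)) →
      GeneralMatching.ErasingRenovationCondition φ (GeneralMatching.palmLaw ℙ X S) z →
        GeneralMatching.averageLaw μ₀ μ₁ ∈ GeneralMatching.Ncond G) ∧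
    (∀ Y : GeneralMatching.PairedInput G → GeneralMatching.QueueDetail G, Measurable Y →
      (∀ ω, Y ω ∈ GeneralMatching.evenQueueDetails G) →
      GeneralMatching.RenovationCondition φ (GeneralMatching.palmLaw ℙ X S) Y →
        ∀ I ∈ GeneralMatching.independentSets G,
          GeneralMatching.averageLaw μ₀ μ₁ I ≤
            GeneralMatching.averageLaw μ₀ μ₁ (GeneralMatching.neighbors G I)) := by
  have : IsProbabilityMeasure (GeneralMatching.palmLaw ℙ X S) :=
    Measure.isProbabilityMeasure_map hinput.measurable_pairing.aemeasurable
  have : IsProbabilityMeasure (GeneralMatching.averageLaw μ₀ μ₁) := hinput.full_support.1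
  have hpres := hinput.ergodic.toMeasurePreserving
  refine ⟨fun r z hr hz hR => ⟨hinput.full_support, fun I hI => ?_⟩, fun Y hY _ hR I _ => ?_⟩
  · have h := hR.integral_drift_neg hr hz hpres hI
    rw [hinput.integral_drift_palmLaw] at h
    exact (ENNReal.toReal_lt_toReal (measure_ne_top _ _) (measure_ne_top _ _)).1
      (by simp only [Measure.real] at h; linarith)
  · have h := hR.integral_drift_nonpos hY hpres I
    rw [hinput.integral_drift_palmLaw] at h
    exact (ENNReal.toReal_le_toReal (measure_ne_top _ _) (measure_ne_top _ _)).1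
      (by simp only [Measure.real] at h; linarith)
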